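/- **Setting.** A belief system consists of a finite set $V$ of $n$ agents, a finite set $W$ of $m$ truth statements, row-stochastic nonnegative matrices $A\in\mathbb R^{V\times V}$ (social network $\mathcal G$) and $C\in\mathbb R^{W\times W}$ (logic constraints $\mathcal T$), and $\Lambda=\mathrm{diag}(\lambda^i)_{i\in V}$ with $0\le\lambda^i\le1$. With $x_k\in[0,1]^{2nm}$ stacking the current and the initial beliefs, the process is $$x_{k+1}=Px_k,\qquad P=\begin{pmatrix}(\Lambda A)\otimes C&(I_n-\Lambda)\otimes I_m\\0&I_{nm}\end{pmatrix}.$$ It converges to equilibrium if $\lim_k x_k=x_\infty$ exists for every $x_0\in[0,1]^{2nm}$. Agent $i$ is stubborn if $\lambda^i<1$, and oblivious if neither $i$ nor any agent that influences $i$, directly or indirectly, is stubborn. For a nonnegative matrix $Q$, the random walk steps from $i$ to $j$ with probability $Q_{ij}$. A strongly connected component (of the graph of positive entries) is closed if no positive entry leads out of it, and aperiodic if the gcd of the lengths of its cycles is $1$. The expected coupling time from $u,v$ is $\mathbb E\min\{t\ge0:X_t=Y_t\}$ for independent walks $X,Y$ with $X_0=u$, $Y_0=v$. All the quantities below take values in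 $[0,\infty]$, and a maximum over the empty set is $0$. * $L_{\mathcal T}$ is the maximum of the expected coupling time of the walk with matrix $C$ over all closed aperiodic strongly connected components of $\mathcal T$ and all pairs of starting points in the component. $L_{\mathcal G}$ is the same for the walk with matrix $A$ and the closed aperiodic strongly connected components of $\mathcal G$ composed of oblivious agents only. * $H_{\mathcal T}$ is the maximum, over all starting points in $W$, of the expected time at which the walk with matrix $C$ first is in a closed strongly connected component of $\mathcal T$. * For $U\subseteq V$, $H_{\mathcal G}(U)$ is the maximum, over all starting points in $U$, of the expected time at which the walk on $\mathcal G$ is absorbed, where the walk with matrix $A$ is absorbed when it is in a closed strongly connected component of $\mathcal G$ composed of oblivious agents only and, as in the graph of $P$, in each step from an agent $i$ it is absorbed with probability $1-\lambda^i$ by the initial belief of that agent. Put $H_{\mathcal G}=H_{\mathcal G}(V)$ and $H^{\mathrm{ob}}_{\mathcal G}=H_{\mathcal G}(\{\text{oblivious agents}\})$; the latter involves the network of oblivious agents only, and the two agree if all agents are oblivious. **Theorem.** Assume that the process converges to equilibrium. Then $P^\infty=\lim_kP^k$ exists. Let $0<\varepsilon\le 9/10$. 1. For every integer $k\ge 32\big(\max\{L_{\mathcal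 T},L_{\mathcal G}\}+\max\{H_{\mathcal T},H_{\mathcal G}\}\big)\log(1/\varepsilon)$ and every node $r$ of the belief system, $$\|P^k(r,\cdot)-P^\infty(r,\cdot)\|_{TV}\le\varepsilon,\qquad |x_k(r)-x_\infty(r)|\le\varepsilon\ \text{ for all }x_0\in[0,1]^{2nm},$$ where $\|\mu-\nu\|_{TV}=\sup_E|\mu(E)-\nu(E)|$. 2. For every integer $k\ge 32\big(\max\{L_{\mathcal T},L_{\mathcal G}\}+\max\{H_{\mathcal T},H^{\mathrm{ob}}_{\mathcal G}\}\big)\log(1/\varepsilon)$ the same two bounds hold at every node $r$ that is the current belief of an oblivious agent on a statement. -/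

import Mathlib

open scoped Kronecker Matrix Topology ENNReal

/-! ### Directed graphs compliant with a nonnegative matrix

`P i j > 0` means that `i` is influenced by `j`, and that the random walk can step from `i` to `j`
(the walk moves against the direction in which the information flows). -/

section Graph

variable {Ω : Type*}

/-- `j` can be reached from `i` along finitely many positive entries of `P`. -/
def Reaches (P : Matrix Ω Ω ℝ) (i j : Ω) : Prop :=
  Relation.ReflTransGen (fun a b => 0 < P a b) i j

/-- `S` is a strongly connected component of the graph of `P`. -/
def IsSCC (P : Matrix Ω Ω ℝ) (S : Set Ω) : Prop :=
  ∃ i, S = {j | Reaches P i j ∧ Reaches P j i}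

/-- `S` is a closed strongly connected component: no node of `S` is influenced from outside `S`,
so that the random walk cannot leave `S`. -/
def IsClosedSCC (P : Matrix Ω Ω ℝ) (S : Set Ω) : Prop :=
  IsSCC P S ∧ ∀ i ∈ S, ∀ j, 0 < P i j → j ∈ S

/-- `l ≥ 1` is the length of a cycle of the graph of `P` inside `S`. -/
def IsCycleLength (P : Matrix Ω Ω ℝ) (S : Set Ω) (l : ℕ) : Prop :=
  1 ≤ l ∧ ∃ p : ℕ → Ω, p 0 = p l ∧ (∀ t ≤ l, p t ∈ S) ∧ ∀ t < l, 0 < P (p t) (p (t + 1))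

/-- The greatest common divisor of the lengths of all cycles in `S` is one. -/
def IsAperiodicOn (P : Matrix Ω Ω ℝ) (S : Set Ω) : Prop :=
  ∀ d : ℕ, (∀ l, IsCycleLength P S l → d ∣ l) → d = 1

end Graph

/-! ### Random walks: hitting, coupling and absorbing times -/

section Walk

variable {Ω : Type*} [Fintype Ω]

open Classical in
/-- `survival P T k i` is the probability `ℙ(τ > k)`, where `τ` is the first time `t ≥ 0` at which
the random walk with transition matrix `P` started at `i` is in the target set `T`. If a row of `P`
sums to less than one, the missing mass is the probability that the walk is stopped in that step;
`τ` is then the first time at which the walk has either been stopped or is in `T`. -/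
noncomputable def survival (P : Matrix Ω Ω ℝ) (T : Set Ω) : ℕ → Ω → ℝ
  | 0, i => if i ∈ T then 0 else 1
  | k + 1, i => if i ∈ T then 0 else ∑ j, P i j * survival P T k j

/-- The expected time `𝔼[τ] = ∑ₖ ℙ(τ > k) ∈ [0, ∞]`, for `τ` as in `survival`. -/
noncomputable def expectedHitting (P : Matrix Ω Ω ℝ) (T : Set Ω) (i : Ω) : ℝ≥0∞ :=
  ∑' k, ENNReal.ofReal (survival P T k i)

/-- The expected coupling time of two independent random walks with transition matrix `P`, started
at `u` and `v`: the pair is a walk with transition matrix `P ⊗ₖ P`, and the coupling time is the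
first time at which it is on the diagonal. -/
noncomputable def expectedCoupling (P : Matrix Ω Ω ℝ) (u v : Ω) : ℝ≥0∞ :=
  expectedHitting (P ⊗ₖ P) {q | q.1 = q.2} (u, v)

/-- The maximal expected coupling time over all closed aperiodic strongly connected components
that lie in `O` and all pairs of initial nodes in the component. -/
noncomputable def maxCoupling (P : Matrix Ω Ω ℝ) (O : Set Ω) : ℝ≥0∞ :=
  ⨆ (S : Set Ω) (_ : IsClosedSCC P S ∧ IsAperiodicOn P S ∧ S ⊆ O) (u ∈ S) (v ∈ S),
    expectedCoupling P u v

/-- The union of the closed strongly connected components that lie in `O`. -/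
def closedNodes (P : Matrix Ω Ω ℝ) (O : Set Ω) : Set Ω :=
  {i | ∃ S, IsClosedSCC P S ∧ S ⊆ O ∧ i ∈ S}

/-- The total variation distance of two distributions on a finite set: the supremum over all
events `E` of `|μ(E) - ν(E)|`. -/
noncomputable def tvDist (μ ν : Ω → ℝ) : ℝ :=
  ⨆ E : Finset Ω, |∑ s ∈ E, μ s - ∑ s ∈ E, ν s|

end Walk

/-! ### Belief systems with logic constraints -/

/-- A belief system with agents `V` and truth statements `W`: the social influence structure `A`,
the multi-issues dependent structure `C`, both row-stochastic, and the parameters `lam i ∈ [0,1]`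
(agent `i` is stubborn if `lam i < 1`). -/
structure BeliefSystem (V W : Type*) [Fintype V] [Fintype W] where
  A : Matrix V V ℝ
  C : Matrix W W ℝ
  lam : V → ℝ
  A_nonneg : ∀ i j, 0 ≤ A i j
  A_row : ∀ i, ∑ j, A i j = 1
  C_nonneg : ∀ u v, 0 ≤ C u v
  C_row : ∀ u, ∑ v, C u v = 1
  lam_nonneg : ∀ i, 0 ≤ lam i
  lam_le_one : ∀ i, lam i ≤ 1

namespace BeliefSystem

variable {V W : Type*} [Fintype V] [DecidableEq V] [Fintype W] [DecidableEq W]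

/-- The matrix of the belief system. The node `inl (i, u)` is the current belief of agent `i` on
statement `u`, the node `inr (i, u)` is the initial belief of agent `i` on statement `u`. -/
def P (B : BeliefSystem V W) : Matrix ((V × W) ⊕ (V × W)) ((V × W) ⊕ (V × W)) ℝ :=
  Matrix.fromBlocks ((Matrix.diagonal B.lam * B.A) ⊗ₖ B.C)
    ((1 - Matrix.diagonal B.lam) ⊗ₖ (1 : Matrix W W ℝ)) 0 1

/-- The process `x_{k+1} = P x_k`. -/
def state (B : BeliefSystem V W) (x₀ : (V × W) ⊕ (V × W) → ℝ) : ℕ → (V × W) ⊕ (V × W) → ℝ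
  | 0 => x₀
  | k + 1 => B.P *ᵥ B.state x₀ k

/-- The process converges from every initial state in `[0,1]^{2nm}`. -/
def ConvergesToEquilibrium (B : BeliefSystem V W) : Prop :=
  ∀ x₀ : (V × W) ⊕ (V × W) → ℝ, (∀ s, x₀ s ∈ Set.Icc (0 : ℝ) 1) →
    ∃ xinf, Filter.Tendsto (B.state x₀) Filter.atTop (𝓝 xinf)

/-- The oblivious agents: those that are not stubborn and are not influenced, directly or
indirectly, by a stubborn agent. -/
def oblivious (B : BeliefSystem V W) : Set V :=
  {i | ∀ j, Reaches B.A i j → B.lam j = 1}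

/-- `L_T`: maximal expected coupling time on the graph of truth statements. -/
noncomputable def LT (B : BeliefSystem V W) : ℝ≥0∞ := maxCoupling B.C Set.univ

/-- `L_G`: maximal expected coupling time on the components of oblivious agents. -/
noncomputable def LG (B : BeliefSystem V W) : ℝ≥0∞ := maxCoupling B.A B.oblivious

/-- `H_T`: maximal expected time until the walk on the graph of truth statements, started
anywhere, is absorbed into a closed strongly connected component. -/
noncomputable def HT (B : BeliefSystem V W) : ℝ≥0∞ :=
  ⨆ u, expectedHitting B.C (closedNodes B.C Set.univ) u

/-- `H_G`: maximal expected time until the walk on the network of agents, started at an agent in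
`U`, is absorbed. The walk is absorbed when it enters a closed strongly connected component
composed by oblivious agents only; moreover, as in the graph of the belief system, at agent `i` it
is absorbed in each step with probability `1 - lam i` by the initial belief of agent `i`. -/
noncomputable def HG (B : BeliefSystem V W) (U : Set V) : ℝ≥0∞ :=
  ⨆ i ∈ U, expectedHitting (Matrix.diagonal B.lam * B.A) (closedNodes B.A B.oblivious) i

/-- At time `k` the belief system is `ε`-close to its limit at the node `r`: the distributions
`P^k(r, ·)` and `P^∞(r, ·)`, by which the initial state is averaged at `r`, have total variation
distance at most `ε`, and for every initial state in `[0,1]^{2nm}` the value at `r` is within `ε`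
of its limit. -/
def CloseAt (B : BeliefSystem V W) (Pinf : Matrix ((V × W) ⊕ (V × W)) ((V × W) ⊕ (V × W)) ℝ)
    (ε : ℝ) (k : ℕ) (r : (V × W) ⊕ (V × W)) : Prop :=
  tvDist ((B.P ^ k) r) (Pinf r) ≤ ε ∧
    ∀ x₀ xinf : (V × W) ⊕ (V × W) → ℝ, (∀ s, x₀ s ∈ Set.Icc (0 : ℝ) 1) →
      Filter.Tendsto (B.state x₀) Filter.atTop (𝓝 xinf) → |B.state x₀ k r - xinf r| ≤ ε

end BeliefSystem

/-! `state x k` averages the initial state over the law of the walk with matrix `P` after `k` steps.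
Write `k = a + t`: the walk has `a` steps to be absorbed and then `t` steps to couple. In a product
of closed components of agents and statements, values after `t` steps differ by at most the
probabilities that two agent walks, or two statement walks, have not met (`abs_state_sub_le`).
Convergence rules out periodic components (`not_convergesToEquilibrium_of_phase`), so the coupling
times `LT` and `LG` control these probabilities. Averaging inside the product preserves the
resulting band, so the limit lies in it too (`abs_state_sub_limit_le`). The error `w = state x t -
y` vanishes at initial beliefs and is now small on closed products. As `y` is fixed by the process,
`a` further steps average `w`, and only walks not yet absorbed see anything but the small values
(`abs_state_inl_le`). Markov's inequality on blocks turns expected times into geometric tails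
(`survival_le_inv_pow`): with `d = 2 * c⁻¹ ^ m` the total error is `d + (1 - d) * d`, and
`exists_block_parameters` makes it at most `ε`. -/

/-! ### Tails of hitting times -/

section Survival

variable {Ω : Type*} [Fintype Ω] {P : Matrix Ω Ω ℝ} {T : Set Ω}

theorem survival_zero_of_notMem {i : Ω} (hi : i ∉ T) : survival P T 0 i = 1 := by
  simp [survival, hi]

theorem survival_succ_of_notMem {i : Ω} (hi : i ∉ T) (k : ℕ) :
    survival P T (k + 1) i = ∑ j, P i j * survival P T k j := by
  simp [survival, hi]

theorem survival_of_mem {i : Ω} (hi : i ∈ T) (k : ℕ) : survival P T k i = 0 := by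
  cases k <;> simp [survival, hi]

theorem survival_nonneg (hP : ∀ i j, 0 ≤ P i j) (k : ℕ) (i : Ω) : 0 ≤ survival P T k i := by
  induction k generalizing i with
  | zero => by_cases hi : i ∈ T <;> simp [survival, hi]
  | succ k ih =>
    by_cases hi : i ∈ T
    · rw [survival_of_mem hi]
    · rw [survival_succ_of_notMem hi]
      exact Finset.sum_nonneg fun j _ => mul_nonneg (hP i j) (ih j)

theorem survival_succ_le (hP : ∀ i j, 0 ≤ P i j) (hrow : ∀ i, ∑ j, P i j ≤ 1) (k : ℕ) (i : Ω) :
    survival P T (k + 1) i ≤ survival P T k i := by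
  induction k generalizing i with
  | zero =>
    by_cases hi : i ∈ T
    · simp [survival_of_mem hi]
    · rw [survival_succ_of_notMem hi, survival_zero_of_notMem hi]
      refine le_trans (Finset.sum_le_sum fun j _ => ?_) (hrow i)
      refine mul_le_of_le_one_right (hP i j) ?_
      by_cases hj : j ∈ T <;> simp [survival, hj]
  | succ k ih =>
    by_cases hi : i ∈ T
    · simp [survival_of_mem hi]
    · rw [survival_succ_of_notMem hi, survival_succ_of_notMem hi]
      exact Finset.sum_le_sum fun j _ => mul_le_mul_of_nonneg_left (ih j) (hP i j)

theorem survival_antitone (hP : ∀ i j, 0 ≤ P i j) (hrow : ∀ i, ∑ j, P i j ≤ 1) (i : Ω) :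
    Antitone fun k => survival P T k i :=
  antitone_nat_of_succ_le fun k => survival_succ_le hP hrow k i

/-- If the walk cannot leave its target, the one-step recursion holds everywhere. -/
theorem survival_succ_of_closed (hP : ∀ i j, 0 ≤ P i j) (hT : ∀ i ∈ T, ∀ j, 0 < P i j → j ∈ T)
    (k : ℕ) (i : Ω) : survival P T (k + 1) i = ∑ j, P i j * survival P T k j := by
  by_cases hi : i ∈ T
  · rw [survival_of_mem hi]
    refine (Finset.sum_eq_zero fun j _ => ?_).symm
    rcases (hP i j).eq_or_lt with h | h
    · simp [← h]
    · simp [survival_of_mem (hT i hi j h)]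
  · exact survival_succ_of_notMem hi k

/-- The Markov property at time `a`. Restricting to a closed set `U` lets the tail bound be assumed
only where the walk can go: on oblivious agents, or on pairs from one component. -/
theorem survival_add_le (hP : ∀ i j, 0 ≤ P i j) {U : Set Ω}
    (hU : ∀ i ∈ U, ∀ j, 0 < P i j → j ∈ U) {b : ℕ} {q : ℝ}
    (hq : ∀ j ∈ U, survival P T b j ≤ q) (a : ℕ) {i : Ω} (hi : i ∈ U) :
    survival P T (a + b) i ≤ survival P T a i * q := by
  induction a generalizing i with
  | zero =>
    by_cases h : i ∈ T
    · simp [survival_of_mem h]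
    · simpa [survival_zero_of_notMem h] using hq i hi
  | succ a ih =>
    by_cases h : i ∈ T
    · simp [survival_of_mem h]
    · rw [Nat.add_right_comm, survival_succ_of_notMem h, survival_succ_of_notMem h,
        Finset.sum_mul]
      refine Finset.sum_le_sum fun j _ => ?_
      rcases (hP i j).eq_or_lt with hj | hj
      · simp [← hj]
      · rw [mul_assoc]
        exact mul_le_mul_of_nonneg_left (ih (hU i hi j hj)) hj.le

theorem survival_mul_le (hP : ∀ i j, 0 ≤ P i j) {U : Set Ω}
    (hU : ∀ i ∈ U, ∀ j, 0 < P i j → j ∈ U) {b : ℕ} {q : ℝ} (hq0 : 0 ≤ q)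
    (hq : ∀ j ∈ U, survival P T b j ≤ q) (m : ℕ) {i : Ω} (hi : i ∈ U) :
    survival P T (m * b) i ≤ q ^ m := by
  induction m with
  | zero => by_cases h : i ∈ T <;> simp [survival, h]
  | succ m ih =>
    rw [Nat.succ_mul, pow_succ]
    exact (survival_add_le hP hU hq _ hi).trans (mul_le_mul_of_nonneg_right ih hq0)

/-- Markov's inequality for hitting times. -/
theorem succ_mul_survival_le (hP : ∀ i j, 0 ≤ P i j) (hrow : ∀ i, ∑ j, P i j ≤ 1) {H : ℝ}
    (hH0 : 0 ≤ H) {i : Ω} (hH : expectedHitting P T i ≤ ENNReal.ofReal H) (b : ℕ) :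
    (b + 1) * survival P T b i ≤ H := by
  rw [← ENNReal.ofReal_le_ofReal_iff hH0]
  refine le_trans ?_ hH
  calc ENNReal.ofReal ((b + 1) * survival P T b i)
      ≤ ENNReal.ofReal (∑ k ∈ Finset.range (b + 1), survival P T k i) := by
        refine ENNReal.ofReal_le_ofReal ?_
        have := Finset.card_nsmul_le_sum (Finset.range (b + 1)) (fun k => survival P T k i)
          (survival P T b i) fun k hk => survival_antitone hP hrow i
            (Nat.lt_succ_iff.mp (Finset.mem_range.mp hk))
        simpa using this
    _ = ∑ k ∈ Finset.range (b + 1), ENNReal.ofReal (survival P T k i) :=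
        ENNReal.ofReal_sum_of_nonneg fun k _ => survival_nonneg hP k i
    _ ≤ expectedHitting P T i := ENNReal.sum_le_tsum _

/-- Geometric decay of the survival probability in terms of the expected hitting time. -/
theorem survival_le_inv_pow (hP : ∀ i j, 0 ≤ P i j) (hrow : ∀ i, ∑ j, P i j ≤ 1) {U : Set Ω}
    (hU : ∀ i ∈ U, ∀ j, 0 < P i j → j ∈ U) {H : ℝ} (hH0 : 0 ≤ H)
    (hH : ∀ i ∈ U, expectedHitting P T i ≤ ENNReal.ofReal H) {c : ℝ} (hc : 0 < c) {m n : ℕ}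
    (hn : m * ⌊c * H⌋₊ ≤ n) {i : Ω} (hi : i ∈ U) : survival P T n i ≤ c⁻¹ ^ m := by
  refine (survival_antitone hP hrow i hn).trans
    (survival_mul_le hP hU (inv_nonneg.mpr hc.le) (fun j hj => ?_) m hi)
  -- One block of `⌊c * H⌋₊` steps suffices for the factor `c⁻¹`: Markov's inequality carries `b +
  -- 1`, which exceeds `c * H`, so nothing is lost by rounding down.
  have h1 := succ_mul_survival_le hP hrow hH0 (hH j hj) ⌊c * H⌋₊
  have h2 := Nat.lt_floor_add_one (c * H)
  have h3 : (0 : ℝ) < ⌊c * H⌋₊ + 1 := by positivity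
  rw [← one_div, le_div_iff₀ hc]
  nlinarith

end Survival

/-! ### Coupling of independent walks -/

section Coupling

variable {Ω : Type*} {M : Matrix Ω Ω ℝ}

theorem sum_kronecker_mul_sub [Fintype Ω] (hrow : ∀ u, ∑ v, M u v = 1) (f : Ω → ℝ) (u v : Ω) :
    ∑ q, (M ⊗ₖ M) (u, v) q * (f q.1 - f q.2) = ∑ w, M u w * f w - ∑ w, M v w * f w := by
  simp only [Fintype.sum_prod_type, Matrix.kroneckerMap_apply, mul_sub, Finset.sum_sub_distrib]
  congr 1
  · refine Finset.sum_congr rfl fun x _ => ?_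
    calc ∑ y, M u x * M v y * f x = (M u x * f x) * ∑ y, M v y := by
          rw [Finset.mul_sum]; exact Finset.sum_congr rfl fun y _ => by ring
      _ = M u x * f x := by rw [hrow, mul_one]
  · rw [Finset.sum_comm]
    refine Finset.sum_congr rfl fun y _ => ?_
    calc ∑ x, M u x * M v y * f y = (∑ x, M u x) * (M v y * f y) := by
          rw [Finset.sum_mul]; exact Finset.sum_congr rfl fun x _ => by ring
      _ = M v y * f y := by rw [hrow, one_mul]

theorem kronecker_self_nonneg (hM : ∀ u v, 0 ≤ M u v) (p q : Ω × Ω) : 0 ≤ (M ⊗ₖ M) p q := by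
  rw [Matrix.kroneckerMap_apply]; exact mul_nonneg (hM _ _) (hM _ _)

theorem kronecker_self_row [Fintype Ω] (hrow : ∀ u, ∑ v, M u v = 1) (p : Ω × Ω) :
    ∑ q, (M ⊗ₖ M) p q = 1 := by
  simp [Fintype.sum_prod_type, Matrix.kroneckerMap_apply, ← Finset.mul_sum, hrow]

theorem kronecker_self_closed (hM : ∀ u v, 0 ≤ M u v) {S : Set Ω}
    (hS : ∀ u ∈ S, ∀ v, 0 < M u v → v ∈ S) :
    ∀ p ∈ S ×ˢ S, ∀ q, 0 < (M ⊗ₖ M) p q → q ∈ S ×ˢ S := by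
  rintro ⟨u, v⟩ ⟨hu, hv⟩ ⟨u', v'⟩ h
  simp only [Matrix.kroneckerMap_apply] at h
  exact ⟨hS u hu u' (pos_of_mul_pos_left h (hM _ _)), hS v hv v' (pos_of_mul_pos_right h (hM _ _))⟩

/-- Coupling inequality: for a process on `ι × Ω` that moves by `N` in the first and by `M` in the
second coordinate, the dependence on the second coordinate is bounded by the probability that two
independent walks have not met yet. -/
theorem abs_sub_le_survival_coupling [Fintype Ω] {ι : Type*} [Fintype ι] {N : Matrix ι ι ℝ}
    (hN : ∀ a b, 0 ≤ N a b) (hNrow : ∀ a, ∑ b, N a b = 1)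
    (hM : ∀ u v, 0 ≤ M u v) (hMrow : ∀ u, ∑ v, M u v = 1) {O : Set ι} {S : Set Ω}
    (hO : ∀ a ∈ O, ∀ b, 0 < N a b → b ∈ O) (hS : ∀ u ∈ S, ∀ v, 0 < M u v → v ∈ S)
    {y : ℕ → ι → Ω → ℝ} (hy0 : ∀ a u, y 0 a u ∈ Set.Icc (0 : ℝ) 1)
    (hy : ∀ t, ∀ a ∈ O, ∀ u ∈ S, y (t + 1) a u = ∑ b, N a b * ∑ v, M u v * y t b v) (t : ℕ)
    {a : ι} (ha : a ∈ O) {u v : Ω} (hu : u ∈ S) (hv : v ∈ S) :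
    |y t a u - y t a v| ≤ survival (M ⊗ₖ M) {q | q.1 = q.2} t (u, v) := by
  -- Independent walks may separate after meeting, so the diagonal is not closed. On it the left
  -- side is zero anyway, and the recursion for `survival` is needed only off it.
  by_cases huv : u = v
  · subst huv
    simpa using survival_nonneg (kronecker_self_nonneg hM) t (u, u)
  have hmem : (u, v) ∉ {q : Ω × Ω | q.1 = q.2} := huv
  induction t generalizing a u v with
  | zero =>
    rw [survival_zero_of_notMem hmem]
    have h1 := hy0 a u
    have h2 := hy0 a v
    exact abs_sub_le_iff.mpr ⟨by linarith [h1.2, h2.1], by linarith [h1.1, h2.2]⟩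
  | succ t ih =>
    have ih' : ∀ b ∈ O, ∀ p ∈ S ×ˢ S, |y t b p.1 - y t b p.2|
        ≤ survival (M ⊗ₖ M) {q | q.1 = q.2} t p := by
      rintro b hb ⟨u', v'⟩ ⟨hu', hv'⟩
      by_cases h : u' = v'
      · subst h
        simpa using survival_nonneg (kronecker_self_nonneg hM) t (u', u')
      · exact ih hb hu' hv' h h
    rw [survival_succ_of_notMem hmem, hy t a ha u hu, hy t a ha v hv, ← Finset.sum_sub_distrib]
    -- The two copies share their first coordinate and move independently in the second.
    simp only [← mul_sub, ← sum_kronecker_mul_sub hMrow]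
    set R := ∑ q, (M ⊗ₖ M) (u, v) q * survival (M ⊗ₖ M) {q | q.1 = q.2} t q with hR
    calc |∑ b, N a b * ∑ q, (M ⊗ₖ M) (u, v) q * (y t b q.1 - y t b q.2)|
        ≤ ∑ b, |N a b * ∑ q, (M ⊗ₖ M) (u, v) q * (y t b q.1 - y t b q.2)| :=
          Finset.abs_sum_le_sum_abs _ _
      _ ≤ ∑ b, N a b * R := by
          refine Finset.sum_le_sum fun b _ => ?_
          rcases (hN a b).eq_or_lt with h | h
          · simp [← h]
          rw [abs_mul, abs_of_pos h]
          refine mul_le_mul_of_nonneg_left ?_ h.le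
          refine (Finset.abs_sum_le_sum_abs _ _).trans (Finset.sum_le_sum fun q _ => ?_)
          rcases (kronecker_self_nonneg hM (u, v) q).eq_or_lt with hq | hq
          · rw [← hq, zero_mul, zero_mul, abs_zero]
          rw [abs_mul, abs_of_pos hq]
          exact mul_le_mul_of_nonneg_left (ih' b (hO a ha b h) q
            (kronecker_self_closed hM hS _ ⟨hu, hv⟩ q hq)) hq.le
      _ = R := by rw [← Finset.sum_mul, hNrow, one_mul]

end Coupling

/-! ### Cyclic phases of periodic components -/

section Period

variable {Ω : Type*}

/-- There is a walk of length `n` from `i` to `j` in the graph of `P`. -/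
def WalkOfLength (P : Matrix Ω Ω ℝ) : ℕ → Ω → Ω → Prop
  | 0, i, j => i = j
  | n + 1, i, j => ∃ k, WalkOfLength P n i k ∧ 0 < P k j

theorem WalkOfLength.trans {P : Matrix Ω Ω ℝ} {m n : ℕ} {i j k : Ω} (h : WalkOfLength P m i j)
    (h' : WalkOfLength P n j k) : WalkOfLength P (m + n) i k := by
  induction n generalizing k with
  | zero => cases h'; exact h
  | succ n ih =>
    obtain ⟨l, hl, hlk⟩ := h'
    exact ⟨l, ih hl, hlk⟩

theorem Reaches.exists_walkOfLength {P : Matrix Ω Ω ℝ} {i j : Ω} (h : Reaches P i j) :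
    ∃ n, WalkOfLength P n i j := by
  induction h with
  | refl => exact ⟨0, rfl⟩
  | tail _ h ih =>
    obtain ⟨n, hn⟩ := ih
    exact ⟨n + 1, _, hn, h⟩

theorem WalkOfLength.exists_path {P : Matrix Ω Ω ℝ} {S : Set Ω}
    (hS : ∀ i ∈ S, ∀ j, 0 < P i j → j ∈ S) {n : ℕ} {i j : Ω} (hi : i ∈ S)
    (h : WalkOfLength P n i j) :
    ∃ p : ℕ → Ω, p 0 = i ∧ p n = j ∧ (∀ t ≤ n, p t ∈ S) ∧ ∀ t < n, 0 < P (p t) (p (t + 1)) := by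
  induction n generalizing j with
  | zero =>
    cases h
    exact ⟨fun _ => i, rfl, rfl, fun _ _ => hi, fun _ h => absurd h (by simp)⟩
  | succ n ih =>
    obtain ⟨k, hk, hkj⟩ := h
    obtain ⟨p, hp0, hpn, hpS, hpP⟩ := ih hk
    refine ⟨fun t => if t ≤ n then p t else j, by simp [hp0], by simp, fun t _ => ?_,
      fun t ht => ?_⟩
    · by_cases h : t ≤ n
      · simpa [h] using hpS t h
      · simpa [h] using hS k (hpn ▸ hpS n le_rfl) j hkj
    · rcases (Nat.lt_succ_iff.mp ht).eq_or_lt with h | h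
      · subst h; simpa [hpn] using hkj
      · simpa [h.le, Nat.succ_le_of_lt h] using hpP t h

/-- If `d` divides all cycle lengths of a closed strongly connected component, the walk moves
cyclically through `d` phases. -/
theorem IsClosedSCC.exists_phase {P : Matrix Ω Ω ℝ} {S : Set Ω} (hS : IsClosedSCC P S) {d : ℕ}
    (hd : ∀ l, IsCycleLength P S l → d ∣ l) :
    ∃ φ : Ω → ZMod d, ∀ i ∈ S, ∀ j, 0 < P i j → φ j = φ i + 1 := by
  obtain ⟨⟨o, rfl⟩, hcl⟩ := hS
  have ho : o ∈ {j | Reaches P o j ∧ Reaches P j o} :=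
    ⟨Relation.ReflTransGen.refl, Relation.ReflTransGen.refl⟩
  have hcyc : ∀ n, WalkOfLength P n o o → d ∣ n := by
    intro n hn
    rcases Nat.eq_zero_or_pos n with rfl | hpos
    · exact dvd_zero d
    · obtain ⟨p, h0, h1, h2, h3⟩ := hn.exists_path hcl ho
      exact hd n ⟨hpos, p, h0.trans h1.symm, h2, h3⟩
  -- The phase of `i` is the length modulo `d` of any walk from `o` to `i`. It is well defined
  -- because one common return walk closes both candidates into cycles.
  have huniq : ∀ {n n' : ℕ} {i : Ω}, Reaches P i o → WalkOfLength P n o i →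
      WalkOfLength P n' o i → (n : ZMod d) = n' := by
    intro n n' i hi h h'
    obtain ⟨l, hl⟩ := hi.exists_walkOfLength
    have e := (ZMod.natCast_eq_zero_iff _ d).mpr (hcyc _ (h.trans hl))
    have e' := (ZMod.natCast_eq_zero_iff _ d).mpr (hcyc _ (h'.trans hl))
    push_cast at e e'
    exact add_right_cancel (e.trans e'.symm)
  classical
  refine ⟨fun i => if h : ∃ n, WalkOfLength P n o i then (h.choose : ZMod d) else 0, ?_⟩
  intro i hi j hij
  have hex := hi.1.exists_walkOfLength
  have hwalk : WalkOfLength P (hex.choose + 1) o j := ⟨i, hex.choose_spec, hij⟩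
  have hex' : ∃ n, WalkOfLength P n o j := ⟨_, hwalk⟩
  simp only [dif_pos hex, dif_pos hex']
  have := huniq (hcl i hi j hij).2 hex'.choose_spec hwalk
  simpa using this

end Period

/-! ### Numerical choice of the blocks -/

/-- A choice of the number and of the relative length of the time blocks for which the resulting
bound on the distance is at most `ε`. -/
theorem exists_block_parameters {ε : ℝ} (hε : 0 < ε) (hε' : ε ≤ 9 / 10) :
    ∃ (m : ℕ) (c : ℝ), 0 < c ∧ m * c ≤ 32 * Real.log (1 / ε) ∧ 2 * c⁻¹ ^ m ≤ 1 ∧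
      2 * c⁻¹ ^ m + (1 - 2 * c⁻¹ ^ m) * (2 * c⁻¹ ^ m) ≤ ε := by
  set l := Real.log (1 / ε) with hl
  have hexp : ε = Real.exp (-l) := by
    rw [hl, one_div, Real.log_inv, neg_neg, Real.exp_log hε]
  have h1 : 1 - l ≤ ε := by have := Real.add_one_le_exp (-l); linarith
  -- This is where `ε ≤ 9 / 10` enters.
  have h2 : (1 : ℝ) / 10 ≤ l := by linarith
  rcases le_total l (3 / 10) with h3 | h3
  · have hc : 0 < 32 * l := by linarith
    -- For small `l` a single block spends the whole budget. With `d = 2 * c⁻¹` the error is `1 - (1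
    -- - d) ^ 2`, so `1 - ε ≤ l ≤ (1 - 2 * b) ^ 2` is enough.
    have key : ∀ b : ℝ, (32 * l)⁻¹ ≤ b → b ≤ 1 / 2 → l ≤ (1 - 2 * b) ^ 2 →
        ∃ (m : ℕ) (c : ℝ), 0 < c ∧ m * c ≤ 32 * l ∧ 2 * c⁻¹ ^ m ≤ 1 ∧
          2 * c⁻¹ ^ m + (1 - 2 * c⁻¹ ^ m) * (2 * c⁻¹ ^ m) ≤ ε := by
      intro b hb hb' hlb
      refine ⟨1, 32 * l, hc, by simp, by rw [pow_one]; linarith, ?_⟩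
      rw [pow_one]
      nlinarith
    have hinv : ∀ b : ℝ, 0 < b → 1 ≤ b * (32 * l) → (32 * l)⁻¹ ≤ b := by
      intro b _ h
      rwa [inv_le_iff_one_le_mul₀ hc]
    rcases le_total l (14 / 100) with h4 | h4
    · exact key (5 / 16) (hinv _ (by norm_num) (by linarith)) (by norm_num) (by norm_num; linarith)
    · exact key (9 / 40) (hinv _ (by norm_num) (by linarith)) (by norm_num) (by norm_num; linarith)
  -- Here `c = 4` and `m = ⌊8 * l⌋₊`. The error is at most `4 * 4⁻¹ ^ m = 4⁻¹ ^ (m - 1)`, and `m - 1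
  -- ≥ l` because `7 * l ≥ 2`.
  · have hm2 : 2 ≤ ⌊8 * l⌋₊ := Nat.le_floor (by push_cast; linarith)
    obtain ⟨n, hn⟩ := Nat.exists_eq_add_of_le' (show 1 ≤ ⌊8 * l⌋₊ by omega)
    have hfl : (⌊8 * l⌋₊ : ℝ) ≤ 8 * l := Nat.floor_le (by linarith)
    have hfl' := Nat.lt_floor_add_one (8 * l)
    have hq : 4 * (4 : ℝ)⁻¹ ^ ⌊8 * l⌋₊ ≤ ε := by
      have hnl : l ≤ n := by rw [hn] at hfl'; push_cast at hfl'; linarith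
      calc 4 * (4 : ℝ)⁻¹ ^ ⌊8 * l⌋₊ = (4 : ℝ)⁻¹ ^ n := by rw [hn, pow_succ]; ring
        _ ≤ (Real.exp (-1)) ^ n := by
            refine pow_le_pow_left₀ (by norm_num) ?_ n
            rw [Real.exp_neg]
            exact inv_anti₀ (Real.exp_pos 1) (by linarith [Real.exp_one_lt_d9])
        _ = Real.exp (-n) := by rw [← Real.exp_nat_mul]; ring_nf
        _ ≤ ε := by rw [hexp]; exact Real.exp_le_exp.mpr (by linarith)
    have hpos : (0 : ℝ) ≤ (4 : ℝ)⁻¹ ^ ⌊8 * l⌋₊ := by positivity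
    exact ⟨⌊8 * l⌋₊, 4, by norm_num, by linarith, by linarith, by nlinarith⟩

/-! ### The process and its matrix -/

namespace BeliefSystem

section

variable {V W : Type*} [Fintype V] [Fintype W] {B : BeliefSystem V W}

theorem lam_of_mem_oblivious {i : V} (hi : i ∈ B.oblivious) : B.lam i = 1 :=
  hi i Relation.ReflTransGen.refl

theorem oblivious_closed : ∀ i ∈ B.oblivious, ∀ j, 0 < B.A i j → j ∈ B.oblivious :=
  fun _ hi _ hij _ hk => hi _ (Relation.ReflTransGen.head hij hk)

variable [DecidableEq V]

theorem diagonal_lam_mul_nonneg (i j : V) : 0 ≤ (Matrix.diagonal B.lam * B.A) i j := by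
  rw [Matrix.diagonal_mul]; exact mul_nonneg (B.lam_nonneg i) (B.A_nonneg i j)

theorem diagonal_lam_mul_row (i : V) : ∑ j, (Matrix.diagonal B.lam * B.A) i j ≤ 1 := by
  simpa [Matrix.diagonal_mul, ← Finset.mul_sum, B.A_row] using B.lam_le_one i

theorem A_pos_of_diagonal_lam_mul_pos {i j : V} (h : 0 < (Matrix.diagonal B.lam * B.A) i j) :
    0 < B.A i j := by
  rw [Matrix.diagonal_mul] at h
  exact pos_of_mul_pos_right h (B.lam_nonneg i)

end

variable {V W : Type*} [Fintype V] [DecidableEq V] [Fintype W] [DecidableEq W]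
  (B : BeliefSystem V W)

theorem state_eq_pow_mulVec (x : (V × W) ⊕ (V × W) → ℝ) (k : ℕ) :
    B.state x k = (B.P ^ k) *ᵥ x := by
  induction k with
  | zero => simp [state]
  | succ k ih => rw [state, ih, pow_succ', Matrix.mulVec_mulVec]

theorem state_add (x : (V × W) ⊕ (V × W) → ℝ) (k t : ℕ) :
    B.state x (k + t) = B.state (B.state x t) k := by
  simp only [state_eq_pow_mulVec, Matrix.mulVec_mulVec, pow_add]

theorem state_sub (x y : (V × W) ⊕ (V × W) → ℝ) (k : ℕ) :
    B.state (x - y) k = B.state x k - B.state y k := by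
  simp only [state_eq_pow_mulVec, Matrix.mulVec_sub]

theorem state_succ_inr (x : (V × W) ⊕ (V × W) → ℝ) (k : ℕ) (p : V × W) :
    B.state x (k + 1) (Sum.inr p) = B.state x k (Sum.inr p) := by
  simp [state, P, Matrix.mulVec, dotProduct, Fintype.sum_sum_type, Matrix.one_apply]

theorem state_inr (x : (V × W) ⊕ (V × W) → ℝ) (k : ℕ) (p : V × W) :
    B.state x k (Sum.inr p) = x (Sum.inr p) := by
  induction k with
  | zero => rfl
  | succ k ih => rw [state_succ_inr, ih]

theorem state_succ_inl (x : (V × W) ⊕ (V × W) → ℝ) (k : ℕ) (i : V) (u : W) :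
    B.state x (k + 1) (Sum.inl (i, u)) =
      (∑ j, B.lam i * B.A i j * ∑ v, B.C u v * B.state x k (Sum.inl (j, v))) +
        (1 - B.lam i) * x (Sum.inr (i, u)) := by
  rw [state, Matrix.mulVec, dotProduct, Fintype.sum_sum_type]
  congr 1
  · simp only [P, Matrix.fromBlocks_apply₁₁, Fintype.sum_prod_type, Matrix.kroneckerMap_apply,
      Matrix.diagonal_mul, Finset.mul_sum, mul_assoc]
  · rw [Finset.sum_eq_single (i, u)]
    · simp [P, state_inr]
    · rintro ⟨j, v⟩ - h
      by_cases hij : i = j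
      · subst hij
        have huv : u ≠ v := fun e => h (by rw [e])
        simp [P, Matrix.one_apply_ne huv]
      · simp [P, Matrix.sub_apply, Matrix.one_apply_ne hij, Matrix.diagonal_apply_ne _ hij]
    · simp

theorem P_nonneg (r s : (V × W) ⊕ (V × W)) : 0 ≤ B.P r s := by
  rcases r with ⟨i, u⟩ | ⟨i, u⟩ <;> rcases s with ⟨j, v⟩ | ⟨j, v⟩
  · simp only [P, Matrix.fromBlocks_apply₁₁, Matrix.kroneckerMap_apply, Matrix.diagonal_mul]
    exact mul_nonneg (mul_nonneg (B.lam_nonneg i) (B.A_nonneg i j)) (B.C_nonneg u v)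
  · simp only [P, Matrix.fromBlocks_apply₁₂, Matrix.kroneckerMap_apply, Matrix.sub_apply,
      Matrix.one_apply, Matrix.diagonal_apply]
    have := B.lam_le_one i
    split_ifs <;> simp [this]
  · simp [P]
  · simp only [P, Matrix.fromBlocks_apply₂₂, Matrix.one_apply]
    split_ifs <;> simp

theorem state_one (k : ℕ) : B.state 1 k = 1 := by
  induction k with
  | zero => rfl
  | succ k ih =>
    funext r
    rcases r with ⟨i, u⟩ | p
    · rw [state_succ_inl, ih]
      simp [C_row, ← Finset.mul_sum, A_row]
    · rw [state_inr]

theorem state_mono {x y : (V × W) ⊕ (V × W) → ℝ} (h : x ≤ y) (k : ℕ) :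
    B.state x k ≤ B.state y k := by
  induction k with
  | zero => exact h
  | succ k ih =>
    exact fun r => Finset.sum_le_sum fun s _ => mul_le_mul_of_nonneg_left (ih s) (B.P_nonneg r s)

theorem state_mem_Icc {x : (V × W) ⊕ (V × W) → ℝ} (hx : ∀ s, x s ∈ Set.Icc (0 : ℝ) 1) (k : ℕ)
    (r : (V × W) ⊕ (V × W)) : B.state x k r ∈ Set.Icc (0 : ℝ) 1 := by
  refine ⟨?_, ?_⟩
  · have := B.state_mono (x := 0) (y := x) (fun s => (hx s).1) k r
    simpa [state_eq_pow_mulVec] using this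
  · have := B.state_mono (x := x) (y := 1) (fun s => (hx s).2) k r
    rwa [state_one] at this

/-! ### Oblivious agents -/

variable {B}

theorem state_succ_of_mem_oblivious (x : (V × W) ⊕ (V × W) → ℝ) (k : ℕ) {i : V}
    (hi : i ∈ B.oblivious) (u : W) : B.state x (k + 1) (Sum.inl (i, u)) =
      ∑ j, B.A i j * ∑ v, B.C u v * B.state x k (Sum.inl (j, v)) := by
  simp [state_succ_inl, lam_of_mem_oblivious hi]

/-- The difference between the beliefs of two oblivious agents on two statements is bounded by
the probabilities that the walks on the two graphs have not coupled. -/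
theorem abs_state_sub_le {x : (V × W) ⊕ (V × W) → ℝ} (hx : ∀ s, x s ∈ Set.Icc (0 : ℝ) 1)
    (t : ℕ) {i j : V} (hi : i ∈ B.oblivious) (hj : j ∈ B.oblivious) (u v : W) :
    |B.state x t (Sum.inl (i, u)) - B.state x t (Sum.inl (j, v))| ≤
      survival (B.A ⊗ₖ B.A) {q | q.1 = q.2} t (i, j) +
        survival (B.C ⊗ₖ B.C) {q | q.1 = q.2} t (u, v) := by
  have h1 := abs_sub_le_survival_coupling (y := fun t u i => B.state x t (Sum.inl (i, u)))
    B.C_nonneg B.C_row B.A_nonneg B.A_row (O := Set.univ) (S := B.oblivious)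
    (fun _ _ _ _ => trivial) oblivious_closed (fun a u => hx _)
    -- The statement is now the shared coordinate, so the two averages are interchanged.
    (fun t u _ i hi => by
      rw [state_succ_of_mem_oblivious x t hi]
      simp only [Finset.mul_sum]
      rw [Finset.sum_comm]
      exact Finset.sum_congr rfl fun _ _ => Finset.sum_congr rfl fun _ _ => by ring)
    t (Set.mem_univ u) hi hj
  have h2 := abs_sub_le_survival_coupling (y := fun t i u => B.state x t (Sum.inl (i, u)))
    B.A_nonneg B.A_row B.C_nonneg B.C_row (O := B.oblivious) (S := Set.univ)
    oblivious_closed (fun _ _ _ _ => trivial) (fun a u => hx _)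
    (fun t i hi u _ => state_succ_of_mem_oblivious x t hi u)
    t hj (Set.mem_univ u) (Set.mem_univ v)
  exact (abs_sub_le _ (B.state x t (Sum.inl (j, u))) _).trans (add_le_add h1 h2)

/-- A bound for the beliefs in a closed part of the network persists. -/
theorem abs_state_sub_const_le {x : (V × W) ⊕ (V × W) → ℝ} {S : Set V} {T : Set W}
    (hSo : S ⊆ B.oblivious) (hS : ∀ i ∈ S, ∀ j, 0 < B.A i j → j ∈ S)
    (hT : ∀ u ∈ T, ∀ v, 0 < B.C u v → v ∈ T) {c δ : ℝ}
    (hx : ∀ i ∈ S, ∀ u ∈ T, |x (Sum.inl (i, u)) - c| ≤ δ) (n : ℕ) :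
    ∀ i ∈ S, ∀ u ∈ T, |B.state x n (Sum.inl (i, u)) - c| ≤ δ := by
  induction n with
  | zero => exact hx
  | succ n ih =>
    intro i hi u hu
    have h : B.state x (n + 1) (Sum.inl (i, u)) - c =
        ∑ j, B.A i j * ∑ v, B.C u v * (B.state x n (Sum.inl (j, v)) - c) := by
      simp only [mul_sub, Finset.sum_sub_distrib, ← Finset.sum_mul, B.C_row, B.A_row, one_mul,
        state_succ_of_mem_oblivious x n (hSo hi)]
    calc |B.state x (n + 1) (Sum.inl (i, u)) - c|
        ≤ ∑ j, B.A i j * ∑ v, B.C u v * δ := by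
          rw [h]
          refine (Finset.abs_sum_le_sum_abs _ _).trans (Finset.sum_le_sum fun j _ => ?_)
          rcases (B.A_nonneg i j).eq_or_lt with hj | hj
          · simp [← hj]
          rw [abs_mul, abs_of_pos hj]
          refine mul_le_mul_of_nonneg_left ?_ hj.le
          refine (Finset.abs_sum_le_sum_abs _ _).trans (Finset.sum_le_sum fun v _ => ?_)
          rcases (B.C_nonneg u v).eq_or_lt with hv | hv
          · simp [← hv]
          rw [abs_mul, abs_of_pos hv]
          exact mul_le_mul_of_nonneg_left (ih j (hS i hi j hj) v (hT u hu v hv)) hv.le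
      _ = δ := by simp [← Finset.sum_mul, B.C_row, B.A_row]

/-! ### Convergence excludes periodic components -/

/-- Started from the indicator of phase zero, the beliefs on `S` and `T` stay a rotating indicator
and oscillate forever. Letting `φ` depend on both coordinates covers periodic agents and periodic
statements at once. -/
theorem not_convergesToEquilibrium_of_phase {S : Set V} {T : Set W} (hSo : S ⊆ B.oblivious)
    (hS : ∀ i ∈ S, ∀ j, 0 < B.A i j → j ∈ S) (hT : ∀ u ∈ T, ∀ v, 0 < B.C u v → v ∈ T)
    {i₀ : V} (hi₀ : i₀ ∈ S) {u₀ : W} (hu₀ : u₀ ∈ T) {d : ℕ} (hd : 2 ≤ d)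
    (φ : V → W → ZMod d) (hφ : ∀ i ∈ S, ∀ u ∈ T, ∀ j v, 0 < B.A i j → 0 < B.C u v →
      φ j v = φ i u + 1) : ¬ B.ConvergesToEquilibrium := by
  intro hconv
  have : Fact (1 < d) := ⟨hd⟩
  have : NeZero d := ⟨by omega⟩
  set x : (V × W) ⊕ (V × W) → ℝ := Sum.elim (fun p => if φ p.1 p.2 = 0 then 1 else 0) 0 with hx
  have hx01 : ∀ s, x s ∈ Set.Icc (0 : ℝ) 1 := by
    rintro (s | s)
    · simp only [hx, Sum.elim_inl]; split_ifs <;> simp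
    · simp [hx]
  have hstate : ∀ k : ℕ, ∀ i ∈ S, ∀ u ∈ T,
      B.state x k (Sum.inl (i, u)) = if φ i u + k = 0 then 1 else 0 := by
    intro k
    induction k with
    | zero => intro i _ u _; simp [state, hx]
    | succ k ih =>
      intro i hi u hu
      rw [state_succ_of_mem_oblivious x k (hSo hi)]
      set c : ℝ := if φ i u + ((k + 1 : ℕ) : ZMod d) = 0 then 1 else 0 with hc
      calc _ = ∑ j, B.A i j * ∑ v, B.C u v * c := by
            refine Finset.sum_congr rfl fun j _ => ?_
            rcases (B.A_nonneg i j).eq_or_lt with hj | hj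
            · simp [← hj]
            congr 1
            refine Finset.sum_congr rfl fun v _ => ?_
            rcases (B.C_nonneg u v).eq_or_lt with hv | hv
            · simp [← hv]
            rw [ih j (hS i hi j hj) v (hT u hu v hv), hφ i hi u hu j v hj hv, hc]
            push_cast
            rw [add_assoc, add_comm 1 (k : ZMod d)]
        _ = c := by simp [← Finset.sum_mul, B.C_row, B.A_row]
  obtain ⟨y, hy⟩ := hconv x hx01
  have hy' := (tendsto_pi_nhds.mp hy) (Sum.inl (i₀, u₀))
  -- At times congruent to `r` modulo `d` the belief is one; a step later it is zero, since `1 ≠ 0`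
  -- in `ZMod d`.
  set r := (-φ i₀ u₀).val with hr
  have hrd : ((r : ℕ) : ZMod d) = -φ i₀ u₀ := by rw [hr, ZMod.natCast_val, ZMod.cast_id]
  have hsub : ∀ a : ℕ, Filter.Tendsto (fun n : ℕ => n * d + a) Filter.atTop Filter.atTop :=
    fun a => Filter.tendsto_atTop_mono 
      (fun n => (Nat.le_mul_of_pos_right n (by omega)).trans (Nat.le_add_right _ a)) Filter.tendsto_id
  have h1 := tendsto_nhds_unique (hy'.comp (hsub r)) (tendsto_const_nhds.congr fun n => by
    show (1 : ℝ) = B.state x (n * d + r) (Sum.inl (i₀, u₀))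
    rw [hstate _ _ hi₀ _ hu₀]; simp [hrd])
  have h0 := tendsto_nhds_unique (hy'.comp (hsub (r + 1))) (tendsto_const_nhds.congr fun n => by
    show (0 : ℝ) = B.state x (n * d + (r + 1)) (Sum.inl (i₀, u₀))
    rw [hstate _ _ hi₀ _ hu₀]; simp [hrd])
  exact one_ne_zero (h1.symm.trans h0)

/-- If all cycle lengths of a set are divisible by some `d ≠ 1`, then by some `d ≥ 2`. -/
theorem _root_.exists_two_le_of_not_isAperiodicOn {Ω : Type*} {M : Matrix Ω Ω ℝ} {S : Set Ω}
    (h : ¬ IsAperiodicOn M S) : ∃ d, 2 ≤ d ∧ ∀ l, IsCycleLength M S l → d ∣ l := by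
  simp only [IsAperiodicOn, not_forall] at h
  obtain ⟨d, hd, hd1⟩ := h
  rcases Nat.eq_zero_or_pos d with rfl | hpos
  -- Divisibility by zero means that there are no cycles at all.
  · exact ⟨2, le_rfl, fun l hl => by rw [Nat.eq_zero_of_zero_dvd (hd l hl)]; exact dvd_zero 2⟩
  · exact ⟨d, by omega, hd⟩

theorem _root_.IsSCC.nonempty {Ω : Type*} {M : Matrix Ω Ω ℝ} {S : Set Ω} (h : IsSCC M S) :
    S.Nonempty := by
  obtain ⟨i, rfl⟩ := h
  exact ⟨i, Relation.ReflTransGen.refl, Relation.ReflTransGen.refl⟩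

theorem ConvergesToEquilibrium.isAperiodicOn (hconv : B.ConvergesToEquilibrium) {S : Set V}
    {T : Set W} (hS : IsClosedSCC B.A S) (hSo : S ⊆ B.oblivious) (hT : IsClosedSCC B.C T) :
    IsAperiodicOn B.A S ∧ IsAperiodicOn B.C T := by
  obtain ⟨i, hi⟩ := hS.1.nonempty
  obtain ⟨u, hu⟩ := hT.1.nonempty
  constructor
  · by_contra h
    obtain ⟨d, hd, hdvd⟩ := exists_two_le_of_not_isAperiodicOn h
    obtain ⟨φ, hφ⟩ := hS.exists_phase hdvd
    exact not_convergesToEquilibrium_of_phase hSo hS.2 hT.2 hi hu hd (fun i _ => φ i)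
      (fun i hi _ _ j _ hij _ => hφ i hi j hij) hconv
  · by_contra h
    obtain ⟨d, hd, hdvd⟩ := exists_two_le_of_not_isAperiodicOn h
    obtain ⟨φ, hφ⟩ := hT.exists_phase hdvd
    exact not_convergesToEquilibrium_of_phase hSo hS.2 hT.2 hi hu hd (fun _ u => φ u)
      (fun _ _ u hu _ v _ huv => hφ u hu v huv) hconv

end BeliefSystem

/-! ### Coupling in closed components, then absorption into them -/

theorem closedNodes_closed {Ω : Type*} [Fintype Ω] {M : Matrix Ω Ω ℝ} {O : Set Ω} :
    ∀ i ∈ closedNodes M O, ∀ j, 0 < M i j → j ∈ closedNodes M O := by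
  rintro i ⟨S, hS, hO, hi⟩ j hij
  exact ⟨S, hS, hO, hS.2 i hi j hij⟩

/-- If the maximal expected coupling time is at most `L`, the walks from two nodes of a closed
aperiodic component couple at a geometric rate. -/
theorem survival_coupling_le {Ω : Type*} [Fintype Ω] {M : Matrix Ω Ω ℝ} (hM : ∀ u v, 0 ≤ M u v)
    (hrow : ∀ u, ∑ v, M u v = 1) {O S : Set Ω} {L : ℝ} (hL0 : 0 ≤ L)
    (hL : maxCoupling M O ≤ ENNReal.ofReal L) (hS : IsClosedSCC M S) (hap : IsAperiodicOn M S)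
    (hSO : S ⊆ O) {c : ℝ} (hc : 0 < c) {m n : ℕ} (hn : m * ⌊c * L⌋₊ ≤ n) {u v : Ω}
    (hu : u ∈ S) (hv : v ∈ S) :
    survival (M ⊗ₖ M) {q | q.1 = q.2} n (u, v) ≤ c⁻¹ ^ m := by
  refine survival_le_inv_pow (kronecker_self_nonneg hM) (fun p => (kronecker_self_row hrow p).le)
    (kronecker_self_closed hM hS.2) hL0 ?_ hc hn (Set.mk_mem_prod hu hv)
  rintro ⟨a, b⟩ ⟨ha, hb⟩
  refine le_trans ?_ hL
  exact le_iSup_of_le S (le_iSup_of_le ⟨hS, hap, hSO⟩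
    (le_iSup₂_of_le a ha (le_iSup₂_of_le (f := fun v _ => expectedCoupling M a v) b hb le_rfl)))

namespace BeliefSystem

variable {V W : Type*} [Fintype V] [DecidableEq V] [Fintype W] [DecidableEq W]
  {B : BeliefSystem V W}

/-- Absorption: a bound at the absorbing nodes spreads up to the probability that the walk has
not been absorbed. -/
theorem abs_state_inl_le {w : (V × W) ⊕ (V × W) → ℝ} {d : ℝ} (hd : d ≤ 1)
    (hw : ∀ s, |w s| ≤ 1) (hwr : ∀ p, |w (Sum.inr p)| ≤ d)
    (hwl : ∀ i ∈ closedNodes B.A B.oblivious, ∀ u ∈ closedNodes B.C Set.univ,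
      |w (Sum.inl (i, u))| ≤ d) (a : ℕ) (i : V) (u : W) :
    |B.state w a (Sum.inl (i, u))| ≤ d + (1 - d) *
      (survival (Matrix.diagonal B.lam * B.A) (closedNodes B.A B.oblivious) a i +
        survival B.C (closedNodes B.C Set.univ) a u) := by
  induction a generalizing i u with
  | zero =>
    rw [state]
    by_cases hi : i ∈ closedNodes B.A B.oblivious
    · by_cases hu : u ∈ closedNodes B.C Set.univ
      · simpa [survival_of_mem hi, survival_of_mem hu] using hwl i hi u hu
      · simpa [survival_of_mem hi, survival_zero_of_notMem hu] using hw _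
    · have h := survival_nonneg (T := closedNodes B.C Set.univ) B.C_nonneg 0 u
      rw [survival_zero_of_notMem hi]
      have := hw (Sum.inl (i, u))
      nlinarith
  | succ a ih =>
    set σ := survival (Matrix.diagonal B.lam * B.A) (closedNodes B.A B.oblivious) with hσ
    set τ := survival B.C (closedNodes B.C Set.univ) with hτ
    have h1 : σ (a + 1) i = ∑ j, B.lam i * B.A i j * σ a j := by
      rw [hσ, survival_succ_of_closed diagonal_lam_mul_nonneg
        (fun i hi j hij => closedNodes_closed i hi j (A_pos_of_diagonal_lam_mul_pos hij))]
      simp only [Matrix.diagonal_mul]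
    have h2 : τ (a + 1) u = ∑ v, B.C u v * τ a v :=
      survival_succ_of_closed B.C_nonneg closedNodes_closed a u
    have h3 : 0 ≤ τ (a + 1) u := survival_nonneg B.C_nonneg _ u
    rw [state_succ_inl]
    calc _ ≤ (∑ j, B.lam i * B.A i j * ∑ v, B.C u v * (d + (1 - d) * (σ a j + τ a v)))
          + (1 - B.lam i) * d := by
          refine (abs_add_le _ _).trans (add_le_add ?_ ?_)
          · refine (Finset.abs_sum_le_sum_abs _ _).trans (Finset.sum_le_sum fun j _ => ?_)
            have hA := mul_nonneg (B.lam_nonneg i) (B.A_nonneg i j)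
            rw [abs_mul, abs_of_nonneg hA]
            refine mul_le_mul_of_nonneg_left ?_ hA
            refine (Finset.abs_sum_le_sum_abs _ _).trans (Finset.sum_le_sum fun v _ => ?_)
            rw [abs_mul, abs_of_nonneg (B.C_nonneg u v)]
            exact mul_le_mul_of_nonneg_left (ih j v) (B.C_nonneg u v)
          · have h := sub_nonneg.mpr (B.lam_le_one i)
            rw [abs_mul, abs_of_nonneg h]
            exact mul_le_mul_of_nonneg_left (hwr _) h
      _ = ∑ j, (B.A i j * (B.lam i * (d + (1 - d) * τ (a + 1) u)) +
            (1 - d) * (B.lam i * B.A i j * σ a j)) + (1 - B.lam i) * d := by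
          congr 1
          refine Finset.sum_congr rfl fun j _ => ?_
          have : ∑ v, B.C u v * (d + (1 - d) * (σ a j + τ a v)) =
              (∑ v, B.C u v) * (d + (1 - d) * σ a j) + (1 - d) * ∑ v, B.C u v * τ a v := by
            rw [Finset.sum_mul, Finset.mul_sum, ← Finset.sum_add_distrib]
            exact Finset.sum_congr rfl fun v _ => by ring
          rw [this, B.C_row, h2]
          ring
      _ = d + (1 - d) * (σ (a + 1) i + B.lam i * τ (a + 1) u) := by
          rw [Finset.sum_add_distrib, ← Finset.sum_mul, B.A_row, ← Finset.mul_sum, ← h1]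
          ring
      -- The statement walk counted by `τ` ignores stopping at initial beliefs, so the factor `B.lam
      -- i` is dropped.
      _ ≤ d + (1 - d) * (σ (a + 1) i + τ (a + 1) u) := by
          have := mul_le_of_le_one_left h3 (B.lam_le_one i)
          have hd' := sub_nonneg.mpr hd
          gcongr

/-- Near a limit, the beliefs in closed components differ from the limit by at most the
probability that the walks have not coupled. -/
theorem abs_state_sub_limit_le (hconv : B.ConvergesToEquilibrium) {L : ℝ} (hL0 : 0 ≤ L)
    (hLT : B.LT ≤ ENNReal.ofReal L) (hLG : B.LG ≤ ENNReal.ofReal L) {c : ℝ} (hc : 0 < c)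
    {m t : ℕ} (ht : m * ⌊c * L⌋₊ ≤ t) {x y : (V × W) ⊕ (V × W) → ℝ}
    (hx : ∀ s, x s ∈ Set.Icc (0 : ℝ) 1)
    (hy : Filter.Tendsto (B.state x) Filter.atTop (𝓝 y)) {i : V}
    (hi : i ∈ closedNodes B.A B.oblivious) {u : W} (hu : u ∈ closedNodes B.C Set.univ) :
    |B.state x t (Sum.inl (i, u)) - y (Sum.inl (i, u))| ≤ 2 * c⁻¹ ^ m := by
  obtain ⟨S, hS, hSo, hiS⟩ := hi
  obtain ⟨T, hT, hTo, huT⟩ := hu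
  obtain ⟨hSa, hTa⟩ := hconv.isAperiodicOn hS hSo hT
  have hosc : ∀ j ∈ S, ∀ v ∈ T,
      |B.state x t (Sum.inl (j, v)) - B.state x t (Sum.inl (i, u))| ≤ 2 * c⁻¹ ^ m := by
    intro j hj v hv
    have h1 := survival_coupling_le B.A_nonneg B.A_row hL0 hLG hS hSa hSo hc ht hj hiS
    have h2 := survival_coupling_le B.C_nonneg B.C_row hL0 hLT hT hTa hTo hc ht hv huT
    linarith [abs_state_sub_le hx t (hSo hj) (hSo hiS) v u]
  have hlim : Filter.Tendsto (fun n => |B.state x t (Sum.inl (i, u)) -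
      B.state x (n + t) (Sum.inl (i, u))|) Filter.atTop
      (𝓝 |B.state x t (Sum.inl (i, u)) - y (Sum.inl (i, u))|) :=
    (tendsto_const_nhds.sub ((tendsto_pi_nhds.mp hy _).comp
      (Filter.tendsto_add_atTop_nat t))).abs
  -- The band around the value of `(i, u)` at time `t` contains all its later values, hence the
  -- limit.
  refine le_of_tendsto' hlim fun n => ?_
  rw [abs_sub_comm, state_add]
  exact abs_state_sub_const_le hSo hS.2 hT.2 hosc n i hiS u huT

/-- A limit is fixed by the process, so by linearity the error evolves by the process itself. -/
theorem state_of_tendsto {x y : (V × W) ⊕ (V × W) → ℝ}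
    (hy : Filter.Tendsto (B.state x) Filter.atTop (𝓝 y)) (k : ℕ) : B.state y k = y := by
  have h1 : Filter.Tendsto (fun n => B.state x (k + n)) Filter.atTop (𝓝 (B.state y k)) := by
    have : Continuous fun z : (V × W) ⊕ (V × W) → ℝ => B.state z k := by
      simp only [state_eq_pow_mulVec]
      exact Continuous.matrix_mulVec continuous_const continuous_id
    simp only [state_add]
    exact (this.tendsto y).comp hy
  have h2 : Filter.Tendsto (fun n => B.state x (k + n)) Filter.atTop (𝓝 y) := by
    simp only [add_comm k]
    exact hy.comp (Filter.tendsto_add_atTop_nat k)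
  exact tendsto_nhds_unique h1 h2

/-- The distance to the limit, for agents in a closed part `U` of the network. -/
theorem abs_state_sub_le_of_blocks (hconv : B.ConvergesToEquilibrium) {U : Set V}
    (hU : ∀ i ∈ U, ∀ j, 0 < B.A i j → j ∈ U) {L H : ℝ} (hL0 : 0 ≤ L) (hH0 : 0 ≤ H)
    (hLT : B.LT ≤ ENNReal.ofReal L) (hLG : B.LG ≤ ENNReal.ofReal L)
    (hHT : B.HT ≤ ENNReal.ofReal H) (hHG : B.HG U ≤ ENNReal.ofReal H) {c : ℝ} (hc : 0 < c)
    {m k : ℕ} (hk : m * c * (L + H) ≤ k) (hcm : 2 * c⁻¹ ^ m ≤ 1)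
    {x y : (V × W) ⊕ (V × W) → ℝ} (hx : ∀ s, x s ∈ Set.Icc (0 : ℝ) 1)
    (hy : Filter.Tendsto (B.state x) Filter.atTop (𝓝 y)) {i : V} (hi : i ∈ U) (u : W) :
    |B.state x k (Sum.inl (i, u)) - y (Sum.inl (i, u))| ≤
      2 * c⁻¹ ^ m + (1 - 2 * c⁻¹ ^ m) * (2 * c⁻¹ ^ m) := by
  have hfl : m * ⌊c * H⌋₊ + m * ⌊c * L⌋₊ ≤ k := by
    have h1 := Nat.floor_le (mul_nonneg hc.le hH0)
    have h2 := Nat.floor_le (mul_nonneg hc.le hL0)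
    have hm : (0 : ℝ) ≤ m := Nat.cast_nonneg m
    have : ((m * ⌊c * H⌋₊ + m * ⌊c * L⌋₊ : ℕ) : ℝ) ≤ k := by
      push_cast
      nlinarith
    exact_mod_cast this
  -- Absorption gets exactly `m` blocks; all remaining time goes to coupling.
  obtain ⟨t, rfl⟩ : ∃ t, k = m * ⌊c * H⌋₊ + t := Nat.exists_eq_add_of_le (by omega)
  have ht : m * ⌊c * L⌋₊ ≤ t := by omega
  set a := m * ⌊c * H⌋₊ with ha
  have hypi := tendsto_pi_nhds.mp hy
  have hy01 : ∀ s, y s ∈ Set.Icc (0 : ℝ) 1 := fun s =>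
    isClosed_Icc.mem_of_tendsto (hypi s)
      (Filter.Eventually.of_forall fun n => B.state_mem_Icc hx n s)
  have hyr : ∀ p, y (Sum.inr p) = x (Sum.inr p) := fun p =>
    tendsto_nhds_unique (hypi _) (tendsto_const_nhds.congr fun n => (B.state_inr x n p).symm)
  have hpos : 0 ≤ 2 * c⁻¹ ^ m := by positivity
  have key := abs_state_inl_le (B := B) (w := B.state x t - y) (d := 2 * c⁻¹ ^ m) hcm
    (fun s => by
      have h1 := B.state_mem_Icc hx t s
      have h2 := hy01 s
      exact abs_sub_le_iff.mpr ⟨by linarith [h1.2, h2.1], by linarith [h1.1, h2.2]⟩)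
    (fun p => by simpa [state_inr, hyr] using hpos)
    (fun i hi u hu => abs_state_sub_limit_le hconv hL0 hLT hLG hc ht hx hy hi hu) a i u
  rw [state_sub, ← state_add, state_of_tendsto hy] at key
  have hG := survival_le_inv_pow (T := closedNodes B.A B.oblivious) (U := U)
    diagonal_lam_mul_nonneg diagonal_lam_mul_row
    (fun i hi j hij => hU i hi j (A_pos_of_diagonal_lam_mul_pos hij)) hH0
    (fun i hi => le_trans (le_iSup₂_of_le (f := fun i _ => expectedHitting
      (Matrix.diagonal B.lam * B.A) (closedNodes B.A B.oblivious) i) i hi le_rfl) hHG)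
    hc (m := m) ha.ge hi
  have hW := survival_le_inv_pow (T := closedNodes B.C Set.univ) (U := Set.univ)
    B.C_nonneg (fun u => (B.C_row u).le) (fun _ _ _ _ => trivial) hH0
    (fun u _ => le_trans (le_iSup (fun u => expectedHitting B.C (closedNodes B.C Set.univ) u) u)
      hHT) hc (m := m) ha.ge (Set.mem_univ u)
  refine key.trans ?_
  have := sub_nonneg.mpr hcm
  gcongr
  linarith

theorem abs_state_sub_le_eps (hconv : B.ConvergesToEquilibrium) {U : Set V}
    (hU : ∀ i ∈ U, ∀ j, 0 < B.A i j → j ∈ U) {ε : ℝ} {k : ℕ} (hε : 0 < ε) (hε' : ε ≤ 9 / 10)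
    (hk : 32 * (max B.LT B.LG + max B.HT (B.HG U)) * ENNReal.ofReal (Real.log (1 / ε))
      ≤ (k : ℝ≥0∞)) {x y : (V × W) ⊕ (V × W) → ℝ} (hx : ∀ s, x s ∈ Set.Icc (0 : ℝ) 1)
    (hy : Filter.Tendsto (B.state x) Filter.atTop (𝓝 y)) {i : V} (hi : i ∈ U) (u : W) :
    |B.state x k (Sum.inl (i, u)) - y (Sum.inl (i, u))| ≤ ε := by
  have hlog : 0 < Real.log (1 / ε) := Real.log_pos (by rw [lt_div_iff₀ hε]; linarith)
  -- Strict positivity of the logarithm matters: `⊤ * 0 = 0` would leave the infinite case open.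
  have hfin : max B.LT B.LG + max B.HT (B.HG U) ≠ ⊤ := by
    intro h
    rw [h, ENNReal.mul_top (by norm_num), ENNReal.top_mul (by simpa using hlog)] at hk
    exact ENNReal.natCast_ne_top k (top_le_iff.mp hk)
  obtain ⟨hL, hH⟩ := ENNReal.add_ne_top.mp hfin
  set L := (max B.LT B.LG).toReal with hLdef
  set H := (max B.HT (B.HG U)).toReal with hHdef
  have hL' : ENNReal.ofReal L = max B.LT B.LG := ENNReal.ofReal_toReal hL
  have hH' : ENNReal.ofReal H = max B.HT (B.HG U) := ENNReal.ofReal_toReal hH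
  have hL0 : 0 ≤ L := ENNReal.toReal_nonneg
  have hH0 : 0 ≤ H := ENNReal.toReal_nonneg
  have hk' : 32 * Real.log (1 / ε) * (L + H) ≤ k := by
    have := ENNReal.toReal_mono (ENNReal.natCast_ne_top k) hk
    rw [ENNReal.toReal_mul, ENNReal.toReal_mul, ENNReal.toReal_add hL hH,
      ENNReal.toReal_ofReal hlog.le, ENNReal.toReal_natCast] at this
    norm_num at this ⊢
    linarith
  obtain ⟨m, c, hc, hmc, hcm, hle⟩ := exists_block_parameters hε hε'
  refine le_trans (abs_state_sub_le_of_blocks hconv hU hL0 hH0 (hL' ▸ le_max_left _ _)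
    (hL' ▸ le_max_right _ _) (hH' ▸ le_max_left _ _) (hH' ▸ le_max_right _ _) hc ?_ hcm hx hy
    hi u) hle
  exact (mul_le_mul_of_nonneg_right hmc (add_nonneg hL0 hH0)).trans hk'

/-! ### Total variation, the limit matrix and the theorem -/

/-- A uniform bound over the initial states gives the total variation bound. -/
theorem closeAt_of_abs_state_sub_le {Q : Matrix ((V × W) ⊕ (V × W)) ((V × W) ⊕ (V × W)) ℝ}
    (hQ : Filter.Tendsto (fun t : ℕ => B.P ^ t) Filter.atTop (𝓝 Q)) {ε : ℝ} {k : ℕ}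
    {r : (V × W) ⊕ (V × W)}
    (h : ∀ x y : (V × W) ⊕ (V × W) → ℝ, (∀ s, x s ∈ Set.Icc (0 : ℝ) 1) →
      Filter.Tendsto (B.state x) Filter.atTop (𝓝 y) → |B.state x k r - y r| ≤ ε) :
    B.CloseAt Q ε k r := by
  refine ⟨ciSup_le fun E => ?_, h⟩
  -- With the indicator of an event as initial state, the value at `r` is the probability of that
  -- event.
  set x : (V × W) ⊕ (V × W) → ℝ := fun s => if s ∈ E then 1 else 0 with hx
  have hlim : Filter.Tendsto (B.state x) Filter.atTop (𝓝 (Q *ᵥ x)) := by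
    have : Continuous fun M : Matrix ((V × W) ⊕ (V × W)) ((V × W) ⊕ (V × W)) ℝ => M *ᵥ x :=
      Continuous.matrix_mulVec continuous_id continuous_const
    exact ((this.tendsto Q).comp hQ).congr fun n => (B.state_eq_pow_mulVec x n).symm
  have := h x _ (fun s => by simp only [hx]; split_ifs <;> simp) hlim
  simpa [state_eq_pow_mulVec, Matrix.mulVec, dotProduct, hx] using this

theorem ConvergesToEquilibrium.exists_tendsto_pow (hconv : B.ConvergesToEquilibrium) :
    ∃ Q : Matrix ((V × W) ⊕ (V × W)) ((V × W) ⊕ (V × W)) ℝ,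
      Filter.Tendsto (fun t : ℕ => B.P ^ t) Filter.atTop (𝓝 Q) := by
  have h : ∀ s, ∃ y, Filter.Tendsto (B.state (Pi.single s 1)) Filter.atTop (𝓝 y) := fun s =>
    hconv _ fun r => by rw [Pi.single_apply]; split_ifs <;> simp
  choose y hy using h
  refine ⟨fun r s => y s r, tendsto_pi_nhds.mpr fun r => tendsto_pi_nhds.mpr fun s => ?_⟩
  refine ((tendsto_pi_nhds.mp (hy s)) r).congr fun n => ?_
  rw [state_eq_pow_mulVec, Matrix.mulVec_single_one]
  rfl

end BeliefSystem

theorem mainTheorem2 {V W : Type*} [Fintype V] [DecidableEq V] [Fintype W] [DecidableEq W]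
    (B : BeliefSystem V W) (hconv : B.ConvergesToEquilibrium) :
    ∃ Pinf : Matrix ((V × W) ⊕ (V × W)) ((V × W) ⊕ (V × W)) ℝ,
      Filter.Tendsto (fun t : ℕ => B.P ^ t) Filter.atTop (𝓝 Pinf) ∧
      ∀ (ε : ℝ) (k : ℕ), 0 < ε → ε ≤ 9 / 10 →
        (32 * (max B.LT B.LG + max B.HT (B.HG Set.univ)) * ENNReal.ofReal (Real.log (1 / ε))
            ≤ (k : ℝ≥0∞) →
          ∀ r, B.CloseAt Pinf ε k r) ∧
        (32 * (max B.LT B.LG + max B.HT (B.HG B.oblivious)) * ENNReal.ofReal (Real.log (1 / ε))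
            ≤ (k : ℝ≥0∞) →
          ∀ i ∈ B.oblivious, ∀ u, B.CloseAt Pinf ε k (Sum.inl (i, u))) := by
  obtain ⟨Q, hQ⟩ := hconv.exists_tendsto_pow
  refine ⟨Q, hQ, fun ε k hε hε' => ⟨fun hk r => ?_, fun hk i hi u => ?_⟩⟩
  -- Initial beliefs never move, so at those nodes the error is zero.
  · refine BeliefSystem.closeAt_of_abs_state_sub_le hQ fun x y hx hy => ?_
    rcases r with ⟨i, u⟩ | p
    · exact BeliefSystem.abs_state_sub_le_eps hconv (fun _ _ _ _ => trivial) hε hε' hk hx hy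
        (Set.mem_univ i) u
    · have : y (Sum.inr p) = x (Sum.inr p) := tendsto_nhds_unique (tendsto_pi_nhds.mp hy _)
        (tendsto_const_nhds.congr fun n => (B.state_inr x n p).symm)
      simpa [BeliefSystem.state_inr, this] using hε.le
  · exact BeliefSystem.closeAt_of_abs_state_sub_le hQ fun x y hx hy =>
      BeliefSystem.abs_state_sub_le_eps hconv BeliefSystem.oblivious_closed hε hε' hk hx hy hi u
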